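/- Let $\mathbb A$ be a finite-dimensional real algebra with unity, not necessarily associative but alternative (the associator $(ab)c-a(bc)$ is an alternating trilinear map), equipped with a real-linear involution $a\mapsto a^c$ satisfying $(a^c)^c=a$ and $(ab)^c=b^ca^c$. Put $\mathbb S_{\mathbb A}=\{x\in\mathbb A: x+x^c=0,\ xx^c=1\}$ and $Q_{\mathbb A}=\mathbb R\cup\{x\in\mathbb A: x+x^c\in\mathbb R,\ xx^c\in\mathbb R,\ 4xx^c>(x+x^c)^2\}$. Let $M$ be a real vector subspace with $\mathbb R\subsetneq M\subseteq Q_{\mathbb A}$, and let $\mathcal B=(v_0,v_1,\dots,v_m)$, $m\ge 1$, be a basis of $M$ with $v_0=1$, with $v_s\in\mathbb S_{\mathbb A}$ for $1\le s\le m$, and with $v_sv_t=-v_tv_s$ for all distinct $s,t\in\{1,\dots,m\}$. Complete $\mathcal B$ to a real basis $(v_0,\dots,v_d)$ of $\mathbb A$, and let $|\cdot|$ be the Euclidean norm on $\mathbb A$ for which this basis is orthonormal. Identify $(x_0,\dots,x_m)\in\mathbb R^{m+1}$ with $\sum_{s=0}^m x_sv_s\in M$. Theorem (Maximum modulus principle).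 Let $\Omega\subset M$ be a bounded domain (nonempty connected open set) with smooth boundary, and let $f:\Omega\to\mathbb A$ be (left) monogenic, i.e. $f$ is of class $C^1$ and $\sum_{s=0}^m v_s\,\frac{\partial f}{\partial x_s}(x)=0$ for all $x\in\Omega$. If $|f|$ has a relative maximum at some point of $\Omega$, then $f$ is constant on $\Omega$. -/

import Mathlib

open scoped ContDiff

/-- The associator `(a * b) * c - a * (b * c)` is an alternating function of its three arguments
(it is additive in each of them in every ring). -/
def IsAlternative (A : Type*) [NonAssocRing A] : Prop :=
  ∀ a b : A, associator a a b = 0 ∧ associator a b a = 0 ∧ associator b a a = 0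

/-- The imaginary units of a `∗`-algebra: trace `x + xᶜ = 0` and squared norm `x xᶜ = 1`. -/
def imaginaryUnits (A : Type*) [NonAssocRing A] [StarRing A] : Set A :=
  {x | x + star x = 0 ∧ x * star x = 1}

/-- The quadratic cone of a real `∗`-algebra, `ℝ` being identified with the multiples of `1`. -/
def quadraticCone (A : Type*) [NonAssocRing A] [Module ℝ A] [StarRing A] : Set A :=
  {x | (∃ r : ℝ, x = r • (1 : A)) ∨
    ∃ t n : ℝ, x + star x = t • (1 : A) ∧ x * star x = n • (1 : A) ∧ t ^ 2 < 4 * n}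

/-- A hypercomplex subspace: `ℝ ⊊ M ⊆ Q_A`. -/
def IsHypercomplexSubspace {A : Type*} [NonAssocRing A] [Module ℝ A] [StarRing A]
    (M : Submodule ℝ A) : Prop :=
  Submodule.span ℝ {(1 : A)} < M ∧ (M : Set A) ⊆ quadraticCone A

/-- An ordered basis `(v₀, …, vₘ)` of `M` is a hypercomplex basis if `m ≥ 1`, `v₀ = 1`, and
`v₁, …, vₘ` are pairwise anticommuting imaginary units. -/
def IsHypercomplexBasis {A : Type*} [NonAssocRing A] [Module ℝ A] [StarRing A]
    {M : Submodule ℝ A} {m : ℕ} (v : Module.Basis (Fin (m + 1)) ℝ M) : Prop :=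
  1 ≤ m ∧ (v 0 : A) = 1 ∧
    (∀ s, s ≠ 0 → (v s : A) ∈ imaginaryUnits A) ∧
    ∀ s t, s ≠ 0 → t ≠ 0 → s ≠ t → (v s : A) * (v t : A) = -((v t : A) * (v s : A))

/-- The Euclidean norm on `A` associated to a basis `(w₀, …, w_d)`, i.e. the one for which this
basis is orthonormal. -/
noncomputable def basisNorm {A : Type*} [NonAssocRing A] [Module ℝ A] {d : ℕ}
    (w : Module.Basis (Fin (d + 1)) ℝ A) (a : A) : ℝ :=
  Real.sqrt (∑ t, w.repr a t ^ 2)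

/-- The `t`-th real component of `f = ∑ t, f_t w_t`. -/
noncomputable def component {A : Type*} [NonAssocRing A] [Module ℝ A] {m d : ℕ}
    (w : Module.Basis (Fin (d + 1)) ℝ A) (f : EuclideanSpace ℝ (Fin (m + 1)) → A)
    (t : Fin (d + 1)) : EuclideanSpace ℝ (Fin (m + 1)) → ℝ :=
  fun x => w.repr (f x) t

/-- The partial derivative `∂f/∂x_s = ∑ t, (∂f_t/∂x_s) w_t` of an `A`-valued function. -/
noncomputable def partialDeriv {A : Type*} [NonAssocRing A] [Module ℝ A] {m d : ℕ}
    (w : Module.Basis (Fin (d + 1)) ℝ A) (f : EuclideanSpace ℝ (Fin (m + 1)) → A)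
    (s : Fin (m + 1)) (x : EuclideanSpace ℝ (Fin (m + 1))) : A :=
  ∑ t, (fderiv ℝ (component w f t) x (EuclideanSpace.single s 1)) • w t

/-- `f` is left monogenic on the open set `Ω` with respect to the basis `v` of `M`, where
`(x₀, …, xₘ) ∈ ℝ^(m+1)` is identified with `∑ s, x_s v_s ∈ M`: its components are of class `C¹`
and `∑ s, v_s (∂f/∂x_s) = 0` on `Ω`. The basis `w` of `A` only serves to take components. -/
def IsLeftMonogenicOn {A : Type*} [NonAssocRing A] [Module ℝ A] {M : Submodule ℝ A} {m d : ℕ}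
    (v : Module.Basis (Fin (m + 1)) ℝ M) (w : Module.Basis (Fin (d + 1)) ℝ A)
    (f : EuclideanSpace ℝ (Fin (m + 1)) → A) (Ω : Set (EuclideanSpace ℝ (Fin (m + 1)))) : Prop :=
  (∀ t, ContDiffOn ℝ 1 (component w f t) Ω) ∧
    ∀ x ∈ Ω, ∑ s, (v s : A) * partialDeriv w f s x = 0

/-- `Ω` has smooth boundary: near each boundary point, `Ω` is the sublevel set `{ρ < 0}` of a
smooth function `ρ` with nonvanishing differential. -/
def HasSmoothBoundary {n : ℕ} (Ω : Set (EuclideanSpace ℝ (Fin n))) : Prop :=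
  ∀ p ∈ frontier Ω, ∃ (U : Set (EuclideanSpace ℝ (Fin n))) (ρ : EuclideanSpace ℝ (Fin n) → ℝ),
    IsOpen U ∧ p ∈ U ∧ ContDiffOn ℝ ∞ ρ U ∧ (∀ x ∈ U, fderiv ℝ ρ x ≠ 0) ∧
      Ω ∩ U = {x ∈ U | ρ x < 0}

/-! Left multiplications by `v s`, and by their conjugates (`v 0` and `-v s` for `s ≠ 0`), satisfy
Clifford relations as linear operators: left alternativity makes this true without associativity.
Formally the conjugate Dirac operator then factors the Laplacian, so a monogenic function is
harmonic componentwise. Since `f` is only `C¹`, second derivatives are avoided and everything is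
drawn from a Cauchy formula (`cauchy_representation`), itself one integration by parts followed by
an approximate identity.

The formula is used twice. Flattening its kernel inside a ball gives a mean value property with
positive weight (`exists_mean_value_weight`). At a maximum `p` of the Euclidean norm, `‖F‖² ≤ ‖F
p‖²` reads `‖F - F p‖² ≤ -2⟪F p, F - F p⟫`; the weighted integral of the right side is zero, so `F`
is constant near `p` (`eventually_eq_of_isLocalMax`). On short segments the kernel extends
holomorphically in the parameter, so the identity theorem propagates vanishing to a ball of
controlled size (`eq_zero_on_ball_of_eventually_eq_zero`), and connectedness finishes. -/

section

open MeasureTheory Filter Topology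

/-! ### Clifford relations and integration by parts -/

/-- The first order operator `u ↦ ∑ s, L s (∂u/∂x_s)` with constant coefficients `L s`. -/
noncomputable def diracOp {n : ℕ} {V : Type*} [NormedAddCommGroup V] [NormedSpace ℝ V]
    (L : Fin n → V →L[ℝ] V) (u : EuclideanSpace ℝ (Fin n) → V) (z : EuclideanSpace ℝ (Fin n)) :
    V :=
  ∑ s, L s (fderiv ℝ u z (EuclideanSpace.single s 1))

/-- The operator valued linear map `z ↦ ∑ r, z_r B r`. -/
noncomputable def opSymbol {n : ℕ} {V : Type*} [NormedAddCommGroup V] [NormedSpace ℝ V]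
    (B : Fin n → V →L[ℝ] V) : EuclideanSpace ℝ (Fin n) →L[ℝ] (V →L[ℝ] V) :=
  ∑ r, (EuclideanSpace.proj r : EuclideanSpace ℝ (Fin n) →L[ℝ] ℝ).smulRight (B r)

/-- The Clifford relations `B r L s + B s L r = 2 δ_rs`. -/
def CliffordPair {n : ℕ} {V : Type*} [NormedAddCommGroup V] [NormedSpace ℝ V]
    (B L : Fin n → V →L[ℝ] V) : Prop :=
  ∀ r s a, B r (L s a) + B s (L r a) = (if r = s then (2 : ℝ) else 0) • a

section
variable {n : ℕ} {V : Type*} [NormedAddCommGroup V] [NormedSpace ℝ V]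

theorem opSymbol_apply (B : Fin n → V →L[ℝ] V) (z : EuclideanSpace ℝ (Fin n)) (a : V) :
    opSymbol B z a = ∑ r, z r • B r a := by
  simp [opSymbol]

theorem opSymbol_single (B : Fin n → V →L[ℝ] V) (s : Fin n) (a : V) :
    opSymbol B (EuclideanSpace.single s 1) a = B s a := by
  simp [opSymbol_apply, ite_smul]

theorem CliffordPair.sum_diag {B L : Fin n → V →L[ℝ] V} (h : CliffordPair B L) (a : V) :
    ∑ s, B s (L s a) = (n : ℝ) • a := by
  have h1 : ∀ s, B s (L s a) = a := by
    intro s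
    have := h s s a
    simp only [if_true] at this
    rw [← two_smul ℝ (B s (L s a))] at this
    exact smul_right_injective V (two_ne_zero (α := ℝ)) this
  simp [h1, Nat.cast_smul_eq_nsmul]

/-- Only the part of `B r (L s a)` symmetric in `r`, `s` is controlled; the coefficients `z r * z s`
are symmetric, so doubling the sum and exchanging indices suffices. -/
theorem CliffordPair.sum_symbol {B L : Fin n → V →L[ℝ] V} (h : CliffordPair B L)
    (z : EuclideanSpace ℝ (Fin n)) (a : V) :
    ∑ s, z s • opSymbol B z (L s a) = (‖z‖ ^ 2) • a := by
  have e1 : ∑ s, z s • opSymbol B z (L s a) = ∑ s, ∑ r, (z s * z r) • B r (L s a) := by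
    simp [opSymbol_apply, Finset.smul_sum, smul_smul]
  have e2 : ∑ s, z s • opSymbol B z (L s a) = ∑ s, ∑ r, (z s * z r) • B s (L r a) := by
    rw [e1, Finset.sum_comm]
    simp only [mul_comm]
  refine smul_right_injective V (two_ne_zero (α := ℝ)) ?_
  change (2 : ℝ) • _ = (2 : ℝ) • _
  rw [two_smul]
  nth_rewrite 1 [e1]
  rw [e2, ← Finset.sum_add_distrib]
  simp_rw [← Finset.sum_add_distrib, ← smul_add]
  have : ∀ s r, (z s * z r) • (B r (L s a) + B s (L r a)) =
      if s = r then (2 * z s ^ 2) • a else 0 := by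
    intro s r
    rw [add_comm, h s r a, smul_smul]
    split_ifs with hsr
    · subst hsr; congr 1; ring
    · simp
  simp_rw [this]
  simp only [Finset.sum_ite_eq, Finset.mem_univ, if_true]
  rw [← Finset.sum_smul, smul_smul, EuclideanSpace.real_norm_sq_eq, Finset.mul_sum]

theorem continuous_radial {k : ℝ → ℝ} (hk : ContinuousOn k (Set.Ici 0)) :
    Continuous fun z : EuclideanSpace ℝ (Fin n) => k (‖z‖ ^ 2) :=
  hk.comp_continuous (by fun_prop) fun z => Set.mem_Ici.2 (sq_nonneg _)

theorem continuous_diracOp (L : Fin n → V →L[ℝ] V) {u : EuclideanSpace ℝ (Fin n) → V}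
    (hu : ContDiff ℝ 1 u) : Continuous (diracOp L u) := by
  have := hu.continuous_fderiv one_ne_zero
  unfold diracOp
  fun_prop

theorem hasCompactSupport_diracOp (L : Fin n → V →L[ℝ] V) {u : EuclideanSpace ℝ (Fin n) → V}
    (hc : HasCompactSupport u) : HasCompactSupport (diracOp L u) := by
  refine (hc.fderiv ℝ).mono fun z hz hz' => hz ?_
  simp [diracOp, hz']

theorem integrable_of_hasCompactSupport_smul {k : EuclideanSpace ℝ (Fin n) → ℝ} (hk : Continuous k)
    {u : EuclideanSpace ℝ (Fin n) → V} (hu : Continuous u) (hc : HasCompactSupport u) :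
    Integrable fun z => k z • u z :=
  (hk.smul hu).integrable_of_hasCompactSupport hc.smul_left

/-- The field `k(‖z‖²) B(z) L s` is differentiated in direction `s`. Summing over `s`, the
derivative of `B(z)` contributes `n k` and that of the radial factor contributes `2‖z‖² k'`, both
scalar by the Clifford relations. -/
theorem integral_radial_dirac [CompleteSpace V] {B L : Fin n → V →L[ℝ] V} (h : CliffordPair B L)
    {k k' : ℝ → ℝ} (hk : ∀ s, 0 ≤ s → HasDerivAt k (k' s) s) (hk' : ContinuousOn k' (Set.Ici 0))
    {u : EuclideanSpace ℝ (Fin n) → V} (hu : ContDiff ℝ 1 u) (hc : HasCompactSupport u) :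
    ∫ z, k (‖z‖ ^ 2) • opSymbol B z (diracOp L u z) =
      -∫ z, (n * k (‖z‖ ^ 2) + 2 * ‖z‖ ^ 2 * k' (‖z‖ ^ 2)) • u z := by
  have ck : Continuous fun z : EuclideanSpace ℝ (Fin n) => k (‖z‖ ^ 2) :=
    continuous_radial fun s hs => (hk s hs).continuousAt.continuousWithinAt
  have ck' : Continuous fun z : EuclideanSpace ℝ (Fin n) => k' (‖z‖ ^ 2) := continuous_radial hk'
  have cu := hu.continuous
  have cdu := hu.continuous_fderiv one_ne_zero
  let Q : Fin n → EuclideanSpace ℝ (Fin n) →L[ℝ] (V →L[ℝ] V) := fun s =>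
    ((ContinuousLinearMap.compL ℝ V V V).flip (L s)) ∘L opSymbol B
  have hQ : ∀ s z a, Q s z a = opSymbol B z (L s a) := fun s z a => rfl
  let F : Fin n → EuclideanSpace ℝ (Fin n) → (V →L[ℝ] V) := fun s z => k (‖z‖ ^ 2) • Q s z
  let F' : Fin n → EuclideanSpace ℝ (Fin n) → (EuclideanSpace ℝ (Fin n) →L[ℝ] (V →L[ℝ] V)) :=
    fun s z => k (‖z‖ ^ 2) • Q s + (k' (‖z‖ ^ 2) • ((2 : ℝ) • innerSL ℝ z)).smulRight (Q s z)
  have hF : ∀ s z, HasFDerivAt (F s) (F' s z) z := by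
    intro s z
    have h1 : HasFDerivAt (fun z : EuclideanSpace ℝ (Fin n) => k (‖z‖ ^ 2))
        (k' (‖z‖ ^ 2) • ((2 : ℝ) • innerSL ℝ z)) z := by
      have := (hasStrictFDerivAt_norm_sq z).hasFDerivAt
      have h2 := (hk (‖z‖ ^ 2) (sq_nonneg _)).comp_hasFDerivAt z this
      exact h2.congr_fderiv (by ext; simp)
    exact h1.smul (Q s).hasFDerivAt
  have hF'a : ∀ s z a, F' s z (EuclideanSpace.single s 1) a =
      k (‖z‖ ^ 2) • B s (L s a) + (2 * k' (‖z‖ ^ 2)) • (z s • opSymbol B z (L s a)) := by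
    intro s z a
    simp only [F', add_apply, smul_apply, hQ,
      opSymbol_single, ContinuousLinearMap.smulRight_apply, innerSL_apply_apply]
    rw [EuclideanSpace.inner_single_right]
    simp [smul_smul]
    ring_nf
  have key : ∀ s, Integrable (fun z => F s z (fderiv ℝ u z (EuclideanSpace.single s 1))) ∧
      Integrable (fun z => F' s z (EuclideanSpace.single s 1) (u z)) ∧
      ∫ z, F s z (fderiv ℝ u z (EuclideanSpace.single s 1)) =
        -∫ z, F' s z (EuclideanSpace.single s 1) (u z) := by
    intro s
    have cF : Continuous (F s) := ck.smul (Q s).continuous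
    have i1 : Integrable (fun z => F s z (fderiv ℝ u z (EuclideanSpace.single s 1))) := by
      refine Continuous.integrable_of_hasCompactSupport
        (cF.clm_apply (cdu.clm_apply continuous_const)) ?_
      refine (hc.fderiv ℝ).mono fun z hz hz' => hz ?_
      simp [hz']
    have i2 : Integrable (fun z => F' s z (EuclideanSpace.single s 1) (u z)) := by
      refine Continuous.integrable_of_hasCompactSupport ?_ ?_
      · simp only [hF'a]
        have cLu := (L s).continuous.comp cu
        have cz : Continuous fun z : EuclideanSpace ℝ (Fin n) => z s := by fun_prop
        exact (ck.smul ((B s).continuous.comp cLu)).add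
          ((continuous_const.mul ck').smul (cz.smul ((opSymbol B).continuous.clm_apply cLu)))
      · refine hc.mono fun z hz hz' => hz ?_
        simp [hz']
    have i3 : Integrable (fun z => F s z (u z)) := by
      refine Continuous.integrable_of_hasCompactSupport (cF.clm_apply cu) ?_
      refine hc.mono fun z hz hz' => hz ?_
      simp [hz']
    exact ⟨i1, i2, integral_bilinear_hasFDerivAt_right_eq_neg_left_of_integrable
      (f := F s) (f' := F' s) (g := u) (g' := fderiv ℝ u) (v := EuclideanSpace.single s 1)
      (B := ContinuousLinearMap.id ℝ (V →L[ℝ] V)) i2 i1 i3 (fun z _ => hF s z)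
      (fun z _ => ((hu.differentiable one_ne_zero) z).hasFDerivAt)⟩
  have e1 : ∀ z, k (‖z‖ ^ 2) • opSymbol B z (diracOp L u z) =
      ∑ s, F s z (fderiv ℝ u z (EuclideanSpace.single s 1)) := by
    intro z
    simp [F, diracOp, hQ, Finset.smul_sum]
  have e2 : ∀ z, (n * k (‖z‖ ^ 2) + 2 * ‖z‖ ^ 2 * k' (‖z‖ ^ 2)) • u z =
      ∑ s, F' s z (EuclideanSpace.single s 1) (u z) := by
    intro z
    simp only [hF'a]
    rw [Finset.sum_add_distrib, ← Finset.smul_sum, ← Finset.smul_sum, h.sum_diag, h.sum_symbol,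
      smul_smul, smul_smul, ← add_smul]
    congr 1; ring
  simp_rw [e1, e2]
  rw [integral_finsetSum _ fun s _ => (key s).1, integral_finsetSum _ fun s _ => (key s).2.1,
    ← Finset.sum_neg_distrib]
  exact Finset.sum_congr rfl fun s _ => (key s).2.2

end

/-! ### The Cauchy formula -/

/-- The total mass of the kernel `n (1 + ‖y‖²) ^ (-(n + 2) / 2)` on `ℝⁿ`. -/
noncomputable def cauchyMass (n : ℕ) : ℝ :=
  ∫ y : EuclideanSpace ℝ (Fin n), (n : ℝ) * (1 + ‖y‖ ^ 2) ^ (-((n : ℝ) + 2) / 2)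

section
variable {n : ℕ} {V : Type*} [NormedAddCommGroup V] [NormedSpace ℝ V]

theorem integrable_cauchyMass (n : ℕ) : Integrable
    fun y : EuclideanSpace ℝ (Fin n) => (n : ℝ) * (1 + ‖y‖ ^ 2) ^ (-((n : ℝ) + 2) / 2) := by
  refine (integrable_rpow_neg_one_add_norm_sq ?_).const_mul _
  simp

theorem cauchyMass_pos (hn : 0 < n) : 0 < cauchyMass n := by
  have hpos : ∀ y : EuclideanSpace ℝ (Fin n),
      0 < (n : ℝ) * (1 + ‖y‖ ^ 2) ^ (-((n : ℝ) + 2) / 2) := fun y => by positivity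
  unfold cauchyMass
  rw [integral_pos_iff_support_of_nonneg (fun y => (hpos y).le) (integrable_cauchyMass n)]
  rw [show (Function.support fun y : EuclideanSpace ℝ (Fin n) =>
      (n : ℝ) * (1 + ‖y‖ ^ 2) ^ (-((n : ℝ) + 2) / 2)) = Set.univ from
    Set.eq_univ_of_forall fun y => (hpos y).ne']
  exact Measure.measure_univ_pos.2 (NeZero.ne _)

theorem integral_radial_dirac_sub [CompleteSpace V] {B L : Fin n → V →L[ℝ] V}
    (h : CliffordPair B L)
    {k k' : ℝ → ℝ} (hk : ∀ s, 0 ≤ s → HasDerivAt k (k' s) s) (hk' : ContinuousOn k' (Set.Ici 0))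
    {u : EuclideanSpace ℝ (Fin n) → V} (hu : ContDiff ℝ 1 u) (hc : HasCompactSupport u)
    (x : EuclideanSpace ℝ (Fin n)) :
    ∫ y, k (‖y - x‖ ^ 2) • opSymbol B (y - x) (diracOp L u y) =
      -∫ y, (n * k (‖y - x‖ ^ 2) + 2 * ‖y - x‖ ^ 2 * k' (‖y - x‖ ^ 2)) • u y := by
  have hu' : ContDiff ℝ 1 fun z => u (z + x) := hu.comp (contDiff_id.add contDiff_const)
  have hc' : HasCompactSupport fun z => u (z + x) := hc.comp_homeomorph (Homeomorph.addRight x)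
  have := integral_radial_dirac h hk hk' hu' hc'
  have hD : ∀ z, diracOp L (fun z => u (z + x)) z = diracOp L u (z + x) := by
    intro z
    simp only [diracOp, fderiv_comp_add_right]
  simp only [hD] at this
  rw [← integral_add_right_eq_self _ x, ← integral_add_right_eq_self (fun y => _ • u y) x]
  simpa using this

/-- The substitution `y ↦ ε y + x` turns the weight into the fixed integrable kernel of
`cauchyMass`; dominated convergence then applies. -/
theorem tendsto_integral_cauchy_approx [CompleteSpace V] {u : EuclideanSpace ℝ (Fin n) → V}
    (hu : Continuous u) (hc : HasCompactSupport u) (x : EuclideanSpace ℝ (Fin n)) :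
    Tendsto (fun ε : ℝ => ∫ y, (n * ε ^ 2 * (‖y - x‖ ^ 2 + ε ^ 2) ^ (-((n : ℝ) + 2) / 2)) • u y)
      (𝓝[>] 0) (𝓝 (cauchyMass n • u x)) := by
  obtain ⟨C, hC⟩ := hc.exists_bound_of_continuous hu
  have e : ∀ ε : ℝ, 0 < ε →
      ∫ y, ((n : ℝ) * (1 + ‖y‖ ^ 2) ^ (-((n : ℝ) + 2) / 2)) • u (ε • y + x) =
      ∫ y, (n * ε ^ 2 * (‖y - x‖ ^ 2 + ε ^ 2) ^ (-((n : ℝ) + 2) / 2)) • u y := by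
    intro ε hε
    rw [← integral_add_right_eq_self (fun y => (_ * (‖y - x‖ ^ 2 + ε ^ 2) ^ _) • u y) x]
    simp only [add_sub_cancel_right]
    have := Measure.integral_comp_smul (volume : Measure (EuclideanSpace ℝ (Fin n)))
      (fun y => (n * ε ^ 2 * (‖y‖ ^ 2 + ε ^ 2) ^ (-((n : ℝ) + 2) / 2)) • u (y + x)) ε
    have hεn : (0 : ℝ) < ε ^ n := by positivity
    rw [finrank_euclideanSpace_fin, abs_of_pos (inv_pos.2 hεn), eq_inv_smul_iff₀ hεn.ne',
      ← integral_smul] at this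
    rw [← this]
    refine integral_congr_ae (Eventually.of_forall fun y => ?_)
    simp only [smul_smul]
    congr 1
    rw [norm_smul, Real.norm_of_nonneg hε.le,
      show (ε * ‖y‖) ^ 2 + ε ^ 2 = ε ^ 2 * (1 + ‖y‖ ^ 2) by ring,
      Real.mul_rpow (by positivity) (by positivity), ← Real.rpow_natCast ε 2, ← Real.rpow_mul hε.le,
      ← Real.rpow_natCast ε n]
    have : ε ^ (n : ℝ) * (ε ^ ((2 : ℕ) : ℝ) * ε ^ (((2 : ℕ) : ℝ) * (-((n : ℝ) + 2) / 2))) = 1 := by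
      rw [← Real.rpow_add hε, ← Real.rpow_add hε]
      convert Real.rpow_zero ε using 2
      push_cast; ring
    linear_combination (-(n : ℝ) * (1 + ‖y‖ ^ 2) ^ (-((n : ℝ) + 2) / 2)) * this
  refine Tendsto.congr' (eventually_nhdsWithin_of_forall fun ε hε => e ε hε) ?_
  rw [cauchyMass, ← integral_smul_const]
  refine tendsto_integral_filter_of_dominated_convergence
    (fun y => ‖(n : ℝ) * (1 + ‖y‖ ^ 2) ^ (-((n : ℝ) + 2) / 2)‖ * C) ?_ ?_ ?_ ?_
  · refine Eventually.of_forall fun ε => ?_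
    exact (integrable_cauchyMass n).aestronglyMeasurable.smul
      (Continuous.aestronglyMeasurable (by fun_prop))
  · refine Eventually.of_forall fun ε => Eventually.of_forall fun y => ?_
    rw [norm_smul]
    exact mul_le_mul_of_nonneg_left (hC _) (norm_nonneg _)
  · exact (integrable_cauchyMass n).norm.mul_const C
  · refine Eventually.of_forall fun y => ?_
    refine Tendsto.smul tendsto_const_nhds ?_
    have : Tendsto (fun ε : ℝ => u (ε • y + x)) (𝓝 0) (𝓝 (u ((0 : ℝ) • y + x))) :=
      Continuous.tendsto (by fun_prop) 0
    simpa using this.mono_left nhdsWithin_le_nhds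

/-- A Cauchy formula: a compactly supported `C¹` function is recovered from its image under the
Dirac operator, provided that this image vanishes near the point of evaluation. -/
theorem cauchy_representation [CompleteSpace V] {B L : Fin n → V →L[ℝ] V} (h : CliffordPair B L)
    {u : EuclideanSpace ℝ (Fin n) → V} (hu : ContDiff ℝ 1 u) (hc : HasCompactSupport u)
    {x : EuclideanSpace ℝ (Fin n)} {δ : ℝ} (hδ : 0 < δ)
    (hx : ∀ y, ‖y - x‖ < δ → diracOp L u y = 0) :
    cauchyMass n • u x =
      -∫ y, ((‖y - x‖ ^ 2) ^ (-(n : ℝ) / 2)) • opSymbol B (y - x) (diracOp L u y) := by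
  have cD := continuous_diracOp L hu
  have cg : Continuous fun y => opSymbol B (y - x) (diracOp L u y) := by
    have : Continuous fun y => opSymbol B (y - x) := by fun_prop
    exact this.clm_apply cD
  have sg : HasCompactSupport fun y => opSymbol B (y - x) (diracOp L u y) := by
    refine (hasCompactSupport_diracOp L hc).mono fun z hz hz' => hz ?_
    simp [hz']
  have t1 := tendsto_integral_cauchy_approx hu.continuous hc x
  have t2 : Tendsto (fun ε : ℝ => ∫ y, ((‖y - x‖ ^ 2 + ε ^ 2) ^ (-(n : ℝ) / 2)) •
      opSymbol B (y - x) (diracOp L u y)) (𝓝[>] 0)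
      (𝓝 (∫ y, ((‖y - x‖ ^ 2) ^ (-(n : ℝ) / 2)) • opSymbol B (y - x) (diracOp L u y))) := by
    refine tendsto_integral_filter_of_dominated_convergence
      (fun y => ((δ ^ 2) ^ (-(n : ℝ) / 2)) * ‖opSymbol B (y - x) (diracOp L u y)‖) ?_ ?_ ?_ ?_
    · refine Eventually.of_forall fun ε => ?_
      have : Measurable fun y : EuclideanSpace ℝ (Fin n) =>
        (‖y - x‖ ^ 2 + ε ^ 2) ^ (-(n : ℝ) / 2) := by fun_prop
      exact this.aestronglyMeasurable.smul cg.aestronglyMeasurable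
    · refine Eventually.of_forall fun ε => Eventually.of_forall fun y => ?_
      by_cases hy : ‖y - x‖ < δ
      · simp [hx y hy]
      · rw [norm_smul]
        refine mul_le_mul_of_nonneg_right ?_ (norm_nonneg _)
        rw [Real.norm_of_nonneg (by positivity)]
        refine Real.rpow_le_rpow_of_nonpos (by positivity) ?_ ?_
        · nlinarith [sq_nonneg ε]
        · have : (0 : ℝ) ≤ n := n.cast_nonneg
          linarith
    · exact (cg.integrable_of_hasCompactSupport sg).norm.const_mul _
    · refine Eventually.of_forall fun y => ?_
      by_cases hy : ‖y - x‖ < δ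
      · simp [hx y hy]
      · refine Tendsto.smul ?_ tendsto_const_nhds
        have hpos : ‖y - x‖ ^ 2 + (0 : ℝ) ^ 2 ≠ 0 := by
          have : 0 < ‖y - x‖ := hδ.trans_le (not_lt.1 hy)
          positivity
        have : Tendsto (fun ε : ℝ => (‖y - x‖ ^ 2 + ε ^ 2) ^ (-(n : ℝ) / 2)) (𝓝 0)
            (𝓝 ((‖y - x‖ ^ 2 + (0 : ℝ) ^ 2) ^ (-(n : ℝ) / 2))) :=
          ContinuousAt.rpow_const (by fun_prop) (Or.inl hpos)
        simpa using this.mono_left nhdsWithin_le_nhds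
  -- For `k s = (s + ε²) ^ (-n/2)`, the combination `n k + 2 s k'` equals `n ε² (s + ε²) ^
  -- (-(n+2)/2)`, the approximate identity.
  have e : ∀ ε : ℝ, 0 < ε → -(∫ y, ((‖y - x‖ ^ 2 + ε ^ 2) ^ (-(n : ℝ) / 2)) •
      opSymbol B (y - x) (diracOp L u y)) =
      ∫ y, (n * ε ^ 2 * (‖y - x‖ ^ 2 + ε ^ 2) ^ (-((n : ℝ) + 2) / 2)) • u y := by
    intro ε hε
    have hd : ∀ s : ℝ, 0 ≤ s → HasDerivAt (fun s : ℝ => (s + ε ^ 2) ^ (-(n : ℝ) / 2))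
        (-(n : ℝ) / 2 * (s + ε ^ 2) ^ (-((n : ℝ) + 2) / 2)) s := by
      intro s hs
      have hp : s + ε ^ 2 ≠ 0 := by positivity
      have := ((hasDerivAt_id s).add_const (ε ^ 2)).rpow_const (p := -(n : ℝ) / 2) (Or.inl hp)
      rw [show -((n : ℝ) + 2) / 2 = -(n : ℝ) / 2 - 1 by ring]
      simpa using this
    have hcont : ContinuousOn (fun s : ℝ => -(n : ℝ) / 2 * (s + ε ^ 2) ^ (-((n : ℝ) + 2) / 2))
        (Set.Ici 0) := by
      refine continuousOn_const.mul (ContinuousOn.rpow_const (by fun_prop) fun s hs => Or.inl ?_)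
      have : (0 : ℝ) ≤ s := hs
      positivity
    rw [integral_radial_dirac_sub h hd hcont hu hc x, neg_neg]
    refine integral_congr_ae (Eventually.of_forall fun y => ?_)
    dsimp only
    congr 1
    have hp : 0 < ‖y - x‖ ^ 2 + ε ^ 2 := by positivity
    rw [show -(n : ℝ) / 2 = -((n : ℝ) + 2) / 2 + 1 by ring, Real.rpow_add_one hp.ne']
    ring
  exact tendsto_nhds_unique t1
    (t2.neg.congr' (eventually_nhdsWithin_of_forall fun ε hε => e ε hε))

/-! ### Mean value property with a positive weight -/

theorem hasDerivAt_tangent_rpow {a R : ℝ} (hR : 0 < R) (s : ℝ) :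
    HasDerivAt (fun s : ℝ => if s ≤ R then R ^ a + a * R ^ (a - 1) * (s - R) else s ^ a)
      (a * (max s R) ^ (a - 1)) s := by
  have d1 : ∀ s : ℝ, HasDerivAt (fun s : ℝ => R ^ a + a * R ^ (a - 1) * (s - R))
      (a * R ^ (a - 1)) s := by
    intro s
    have := (((hasDerivAt_id s).sub_const R).const_mul (a * R ^ (a - 1))).const_add (R ^ a)
    simpa using this
  rcases lt_trichotomy s R with hs | rfl | hs
  · rw [max_eq_right hs.le]
    refine (d1 s).congr_of_eventuallyEq ?_
    filter_upwards [eventually_lt_nhds hs] with t ht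
    simp [ht.le]
  · rw [max_self, ← hasDerivWithinAt_univ, ← Set.Iic_union_Ici (a := s)]
    refine HasDerivWithinAt.union ?_ ?_
    · exact (d1 s).hasDerivWithinAt.congr (fun t ht => if_pos ht) (by simp)
    · refine (Real.hasDerivAt_rpow_const (Or.inl hR.ne')).hasDerivWithinAt.congr (fun t ht => ?_)
        (by simp)
      rcases (Set.mem_Ici.1 ht).eq_or_lt with rfl | ht
      · simp
      · simp [not_le.2 ht]
  · rw [max_eq_left hs.le]
    refine (Real.hasDerivAt_rpow_const (Or.inl (hR.trans hs).ne')).congr_of_eventuallyEq ?_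
    filter_upwards [eventually_gt_nhds hs] with t ht
    simp [not_le.2 ht]

/-- A weighted mean value formula, with a weight that is positive on a ball and vanishes outside. -/
theorem exists_mean_value_weight [CompleteSpace V] (hn : 0 < n) {B L : Fin n → V →L[ℝ] V}
    (h : CliffordPair B L) {R : ℝ} (hR : 0 < R) :
    ∃ q : ℝ → ℝ, ContinuousOn q (Set.Ici 0) ∧ (∀ s, 0 ≤ s → s < R → 0 < q s) ∧
      (∀ s, R ≤ s → q s = 0) ∧
      ∀ (u : EuclideanSpace ℝ (Fin n) → V) (x : EuclideanSpace ℝ (Fin n)), ContDiff ℝ 1 u →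
        HasCompactSupport u → (∀ y, ‖y - x‖ ^ 2 < R → diracOp L u y = 0) →
        cauchyMass n • u x = ∫ y, q (‖y - x‖ ^ 2) • u y := by
  obtain ⟨a, ha⟩ : ∃ a : ℝ, a = -(n : ℝ) / 2 := ⟨_, rfl⟩
  -- The Cauchy kernel `s ^ (-n/2)` is replaced by its tangent line at `R` for `s ≤ R`. This keeps
  -- it `C¹` and leaves the Cauchy integral unchanged, as `diracOp L u` vanishes there. Outside, `s
  -- ^ (-n/2)` solves `n H + 2 s H' = 0`.
  set H : ℝ → ℝ := fun s => if s ≤ R then R ^ a + a * R ^ (a - 1) * (s - R) else s ^ a with hH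
  set H' : ℝ → ℝ := fun s => a * (max s R) ^ (a - 1) with hH'
  have hd : ∀ s, HasDerivAt H (H' s) s := hasDerivAt_tangent_rpow hR
  have hc' : Continuous H' := by
    refine continuous_const.mul (Continuous.rpow_const (by fun_prop) fun s => Or.inl ?_)
    exact (hR.trans_le (le_max_right _ _)).ne'
  have hcH : Continuous H := continuous_iff_continuousAt.2 fun s => (hd s).continuousAt
  have hn' : (0 : ℝ) < n := by exact_mod_cast hn
  have hHge : ∀ s, R ≤ s → H s = s ^ a := by
    intro s hs
    rcases hs.eq_or_lt with rfl | hs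
    · simp [hH]
    · simp [hH, not_le.2 hs]
  refine ⟨fun s => n * H s + 2 * s * H' s, by fun_prop, ?_, ?_, ?_⟩
  · intro s hs0 hs
    have e1 : R ^ a = R * R ^ (a - 1) := by
      rw [Real.rpow_sub_one hR.ne']; field_simp
    have hp : 0 < R ^ (a - 1) := by positivity
    have : (n : ℝ) * H s + 2 * s * H' s = n * R ^ (a - 1) * ((R - s) * (1 + n / 2)) := by
      simp only [hH, hH', if_pos hs.le, max_eq_right hs.le]
      linear_combination n * e1 + R ^ (a - 1) * (n * (s - R) + 2 * s) * ha
    dsimp only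
    rw [this]
    have : 0 < R - s := sub_pos.2 hs
    positivity
  · intro s hs
    have hs0 : 0 < s := hR.trans_le hs
    have e1 : s ^ a = s * s ^ (a - 1) := by
      rw [Real.rpow_sub_one hs0.ne']; field_simp
    simp only [hHge s hs, hH', max_eq_left hs]
    linear_combination n * e1 + 2 * s * s ^ (a - 1) * ha
  · intro u x hu hc hx
    have hδ : 0 < Real.sqrt R := Real.sqrt_pos.2 hR
    rw [cauchy_representation h hu hc hδ (x := x) fun y hy => hx y
        ((Real.lt_sqrt (norm_nonneg _)).1 hy),
      ← neg_neg (∫ y, _ • u y),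
      ← integral_radial_dirac_sub h (fun s _ => hd s) hc'.continuousOn hu hc x, ← ha]
    congr 1
    refine integral_congr_ae (Eventually.of_forall fun y => ?_)
    dsimp only
    by_cases hy : ‖y - x‖ ^ 2 < R
    · simp [hx y hy]
    · rw [hHge _ (not_lt.1 hy)]
end

/-! ### Localization and unique continuation -/

section
variable {n : ℕ} {V : Type*} [NormedAddCommGroup V] [NormedSpace ℝ V]

theorem diracOp_congr {L : Fin n → V →L[ℝ] V} {u F : EuclideanSpace ℝ (Fin n) → V}
    {x : EuclideanSpace ℝ (Fin n)} (h : u =ᶠ[𝓝 x] F) : diracOp L u x = diracOp L F x := by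
  simp only [diracOp, h.fderiv_eq]

theorem diracOp_sub_const {L : Fin n → V →L[ℝ] V} (F : EuclideanSpace ℝ (Fin n) → V) (a : V)
    (x : EuclideanSpace ℝ (Fin n)) : diracOp L (fun y => F y - a) x = diracOp L F x := by
  simp only [diracOp, fderiv_sub_const]

theorem exists_cutoff {L : Fin n → V →L[ℝ] V} {Ω : Set (EuclideanSpace ℝ (Fin n))}
    (hΩ : IsOpen Ω) {F : EuclideanSpace ℝ (Fin n) → V} (hF : ContDiffOn ℝ 1 F Ω)
    (hD : ∀ x ∈ Ω, diracOp L F x = 0) {p : EuclideanSpace ℝ (Fin n)} {r r' : ℝ} (hr : 0 < r)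
    (hr' : r < r') (hp : Metric.closedBall p r' ⊆ Ω) :
    ∃ u : EuclideanSpace ℝ (Fin n) → V, ContDiff ℝ 1 u ∧ HasCompactSupport u ∧
      (∀ y ∈ Metric.ball p r, u y = F y) ∧ ∀ y ∈ Metric.ball p r, diracOp L u y = 0 := by
  let χ : ContDiffBump p := ⟨r, r', hr, hr'⟩
  have hsub : tsupport (fun y => χ y • F y) ⊆ Metric.closedBall p r' :=
    (tsupport_smul_subset_left _ _).trans χ.tsupport_eq.subset
  have heq : ∀ y ∈ Metric.ball p r, χ y • F y = F y := fun y hy => by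
    rw [χ.one_of_mem_closedBall (Metric.ball_subset_closedBall hy), one_smul]
  refine ⟨fun y => χ y • F y, ?_, χ.hasCompactSupport.smul_right, heq, ?_⟩
  · refine contDiff_iff_contDiffAt.2 fun y => ?_
    by_cases hy : y ∈ tsupport fun y => χ y • F y
    · exact χ.contDiffAt.smul (hF.contDiffAt (hΩ.mem_nhds (hp (hsub hy))))
    · exact contDiffAt_const.congr_of_eventuallyEq (notMem_tsupport_iff_eventuallyEq.1 hy)
  · intro y hy
    have hy' : y ∈ Ω := hp (Metric.closedBall_subset_closedBall hr'.le
      (Metric.ball_subset_closedBall hy))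
    rw [← hD y hy']
    refine diracOp_congr ?_
    filter_upwards [Metric.isOpen_ball.mem_nhds hy] with z hz using heq z hz

/-- The base of the power is `‖y - p - t e‖²` with the real `t` replaced by a complex `ζ`. -/
theorem differentiableOn_integral_cpow {p e : EuclideanSpace ℝ (Fin n)} {ρ : ℝ} (hρ : 0 < ρ)
    (he : ‖e‖ ≤ ρ / 8) (a : ℝ) (ha : a ≤ 0) {g : EuclideanSpace ℝ (Fin n) → ℝ} (hg : Continuous g)
    (hc : HasCompactSupport g) (h0 : ∀ y, ‖y - p‖ < ρ → g y = 0) :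
    DifferentiableOn ℂ (fun ζ : ℂ => ∫ y, ((‖y - p‖ ^ 2 : ℝ) - 2 * ζ * (inner ℝ (y - p) e : ℝ) +
      ζ ^ 2 * (‖e‖ ^ 2 : ℝ) : ℂ) ^ (a : ℂ) * (g y : ℂ)) (Metric.ball 0 2) := by
  let b : ℂ → EuclideanSpace ℝ (Fin n) → ℂ := fun ζ y =>
    (‖y - p‖ ^ 2 : ℝ) - 2 * ζ * (inner ℝ (y - p) e : ℝ) + ζ ^ 2 * (‖e‖ ^ 2 : ℝ)
  let b' : ℂ → EuclideanSpace ℝ (Fin n) → ℂ := fun ζ y =>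
    -(2 * (inner ℝ (y - p) e : ℝ)) + 2 * ζ * (‖e‖ ^ 2 : ℝ)
  have hb : ∀ ζ y, HasDerivAt (fun ζ => b ζ y) (b' ζ y) ζ := by
    intro ζ y
    have h1 := ((hasDerivAt_id ζ).const_mul (2 : ℂ)).mul_const ((inner ℝ (y - p) e : ℝ) : ℂ)
    have h2 := ((hasDerivAt_id ζ).pow 2).mul_const ((‖e‖ ^ 2 : ℝ) : ℂ)
    have := (h1.const_sub ((‖y - p‖ ^ 2 : ℝ) : ℂ)).add h2
    exact HasDerivAt.congr_deriv (f := fun ζ => b ζ y) this (by simp [b'])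
  -- For `|ζ| < 2` and `‖e‖ ≤ ‖y - p‖ / 8` the perturbation is at most `(1/2 + 1/16) ‖y - p‖²`, so
  -- the base stays in the right half-plane, off the branch cut.
  have hre : ∀ ζ ∈ Metric.ball (0 : ℂ) 2, ∀ y, ρ ≤ ‖y - p‖ → ρ ^ 2 / 4 ≤ (b ζ y).re := by
    intro ζ hζ y hy
    have hζ : ‖ζ‖ < 2 := by simpa using hζ
    have e1 : (b ζ y).re = ‖y - p‖ ^ 2 + (-(2 * ζ * (inner ℝ (y - p) e : ℝ)) +
        ζ ^ 2 * (‖e‖ ^ 2 : ℝ) : ℂ).re := by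
      simp only [b, Complex.add_re, Complex.sub_re, Complex.neg_re, Complex.ofReal_re]
      ring
    have e2 : ‖(-(2 * ζ * (inner ℝ (y - p) e : ℝ)) + ζ ^ 2 * (‖e‖ ^ 2 : ℝ) : ℂ)‖ ≤
        4 * (‖y - p‖ * ‖e‖) + 4 * ‖e‖ ^ 2 := by
      refine (norm_add_le _ _).trans (add_le_add ?_ ?_)
      · rw [norm_neg, norm_mul, norm_mul, Complex.norm_real, Complex.norm_ofNat]
        exact mul_le_mul (by linarith) (norm_inner_le_norm _ _) (norm_nonneg _) (by norm_num)
      · rw [norm_mul, norm_pow, Complex.norm_real, Real.norm_of_nonneg (sq_nonneg _)]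
        refine mul_le_mul_of_nonneg_right ?_ (sq_nonneg _)
        nlinarith [norm_nonneg ζ]
    have e3 := (abs_le.1 ((Complex.abs_re_le_norm _).trans e2)).1
    have hw := norm_nonneg (y - p)
    have he' : ‖e‖ ≤ ‖y - p‖ / 8 := he.trans (by linarith)
    have e4 : ‖y - p‖ * ‖e‖ ≤ ‖y - p‖ * (‖y - p‖ / 8) := mul_le_mul_of_nonneg_left he' hw
    have e5 : ‖e‖ ^ 2 ≤ (‖y - p‖ / 8) ^ 2 := pow_le_pow_left₀ (norm_nonneg _) he' 2
    have e6 : ρ ^ 2 ≤ ‖y - p‖ ^ 2 := pow_le_pow_left₀ hρ.le hy 2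
    rw [e1]
    nlinarith
  have hb'n : ∀ ζ ∈ Metric.ball (0 : ℂ) 2, ∀ y, ‖b' ζ y‖ ≤ 2 * (‖y - p‖ * ‖e‖) + 4 * ‖e‖ ^ 2 := by
    intro ζ hζ y
    have hζ : ‖ζ‖ < 2 := by simpa using hζ
    refine (norm_add_le _ _).trans (add_le_add ?_ ?_)
    · rw [norm_neg, norm_mul, Complex.norm_real, Complex.norm_ofNat]
      exact mul_le_mul_of_nonneg_left (norm_inner_le_norm _ _) (by norm_num)
    · rw [norm_mul, norm_mul, Complex.norm_real, Real.norm_of_nonneg (sq_nonneg _),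
        Complex.norm_ofNat]
      refine mul_le_mul_of_nonneg_right ?_ (sq_nonneg _)
      linarith
  have hcpow : ∀ t : ℝ, t ≤ 0 → ∀ ζ ∈ Metric.ball (0 : ℂ) 2, ∀ y, ρ ≤ ‖y - p‖ →
      ‖b ζ y ^ (t : ℂ)‖ ≤ (ρ ^ 2 / 4) ^ t := by
    intro t ht ζ hζ y hy
    have h1 := hre ζ hζ y hy
    have hpos : 0 < ρ ^ 2 / 4 := by positivity
    have hne : b ζ y ≠ 0 := fun h => by
      rw [h] at h1; simp at h1; linarith
    rw [Complex.norm_cpow_of_ne_zero hne]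
    simp only [Complex.ofReal_re, Complex.ofReal_im, mul_zero, Real.exp_zero, div_one]
    exact Real.rpow_le_rpow_of_nonpos hpos (h1.trans (Complex.re_le_norm _)) ht
  have hmeas : ∀ (t : ℂ) ζ, Measurable fun y => b ζ y ^ t := fun t ζ =>
    Measurable.pow_const (Continuous.measurable (by fun_prop)) t
  have hgm : Measurable fun y => (g y : ℂ) := Complex.measurable_ofReal.comp hg.measurable
  intro ζ hζ
  refine DifferentiableAt.differentiableWithinAt ?_
  have hgi : Integrable g := hg.integrable_of_hasCompactSupport hc
  refine (hasDerivAt_integral_of_dominated_loc_of_deriv_le (𝕜 := ℂ)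
    (F := fun ζ y => b ζ y ^ (a : ℂ) * (g y : ℂ))
    (F' := fun ζ y => (a * b ζ y ^ ((a : ℂ) - 1) * b' ζ y) * (g y : ℂ))
    (bound := fun y => (|a| * (ρ ^ 2 / 4) ^ (a - 1) * (2 * (‖y - p‖ * ‖e‖) + 4 * ‖e‖ ^ 2)) * ‖g y‖)
    (Metric.isOpen_ball.mem_nhds hζ) ?_ ?_ ?_ ?_ ?_ ?_).2.differentiableAt
  · exact Eventually.of_forall fun ζ => ((hmeas a ζ).mul hgm).aestronglyMeasurable
  · refine (hgi.norm.const_mul ((ρ ^ 2 / 4) ^ a)).mono' ((hmeas a ζ).mul hgm).aestronglyMeasurable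
      (Eventually.of_forall fun y => ?_)
    by_cases hy : ‖y - p‖ < ρ
    · simp [h0 y hy]
    · rw [norm_mul, Complex.norm_real]
      exact mul_le_mul_of_nonneg_right (hcpow a ha ζ hζ y (not_lt.1 hy)) (norm_nonneg _)
  · have hb'm : Measurable fun y => b' ζ y := Continuous.measurable (by fun_prop)
    exact ((((hmeas _ ζ).const_mul _).mul hb'm).mul hgm).aestronglyMeasurable
  · refine Eventually.of_forall fun y ζ hζ => ?_
    by_cases hy : ‖y - p‖ < ρ
    · simp [h0 y hy]
    · rw [norm_mul, norm_mul, norm_mul, Complex.norm_real, Complex.norm_real, Real.norm_eq_abs]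
      have h1 := hcpow (a - 1) (by linarith) ζ hζ y (not_lt.1 hy)
      rw [Complex.ofReal_sub, Complex.ofReal_one] at h1
      have h2 := hb'n ζ hζ y
      gcongr
  · refine Continuous.integrable_of_hasCompactSupport (by fun_prop) ?_
    exact hc.norm.mul_left
  · refine Eventually.of_forall fun y ζ hζ => ?_
    by_cases hy : ‖y - p‖ < ρ
    · simpa [h0 y hy] using hasDerivAt_const ζ (0 : ℂ)
    · refine HasDerivAt.mul_const ?_ _
      refine (hb ζ y).cpow_const (Or.inl ?_)
      have := hre ζ hζ y (not_lt.1 hy)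
      have hpos : 0 < ρ ^ 2 / 4 := by positivity
      linarith

theorem integrable_kernel_smul {x : EuclideanSpace ℝ (Fin n)} {δ a : ℝ} (hδ : 0 < δ) (ha : a ≤ 0)
    {g : EuclideanSpace ℝ (Fin n) → V} (hg : Continuous g) (hc : HasCompactSupport g)
    (h0 : ∀ y, ‖y - x‖ < δ → g y = 0) : Integrable fun y => ((‖y - x‖ ^ 2) ^ a) • g y := by
  have hm : Measurable fun y : EuclideanSpace ℝ (Fin n) => (‖y - x‖ ^ 2) ^ a := by fun_prop
  refine ((hg.integrable_of_hasCompactSupport hc).norm.const_mul ((δ ^ 2) ^ a)).mono'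
    (hm.aestronglyMeasurable.smul hg.aestronglyMeasurable) (Eventually.of_forall fun y => ?_)
  by_cases hy : ‖y - x‖ < δ
  · simp [h0 y hy]
  · rw [norm_smul, Real.norm_of_nonneg (by positivity)]
    refine mul_le_mul_of_nonneg_right ?_ (norm_nonneg _)
    exact Real.rpow_le_rpow_of_nonpos (by positivity)
      (pow_le_pow_left₀ hδ.le (not_lt.1 hy) 2) ha

/-- Along `t ↦ p + t (x - p)` the Cauchy integral, tested against a functional, is holomorphic in
`|ζ| < 2`. It vanishes for small real `t`, hence also at `t = 1`. The radius depends only on `R`,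
not on where `F` is known to vanish. -/
theorem eq_zero_on_ball_of_eventually_eq_zero [CompleteSpace V] (hn : 0 < n)
    {B L : Fin n → V →L[ℝ] V} (h : CliffordPair B L) {Ω : Set (EuclideanSpace ℝ (Fin n))}
    (hΩ : IsOpen Ω) {F : EuclideanSpace ℝ (Fin n) → V} (hF : ContDiffOn ℝ 1 F Ω)
    (hD : ∀ x ∈ Ω, diracOp L F x = 0) {p : EuclideanSpace ℝ (Fin n)} {R : ℝ} (hR : 0 < R)
    (hp : Metric.closedBall p R ⊆ Ω) (h0 : F =ᶠ[𝓝 p] 0) {x : EuclideanSpace ℝ (Fin n)}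
    (hx : ‖x - p‖ < R / 16) : F x = 0 := by
  obtain ⟨u, hu, hc, huF, huD⟩ := exists_cutoff hΩ hF hD (half_pos hR) (half_lt_self hR) hp
  set e := x - p with he
  have cD := continuous_diracOp L hu
  have sD := hasCompactSupport_diracOp L hc
  refine SeparatingDual.eq_zero_of_forall_dual_eq_zero (R := ℝ) fun φ => ?_
  let G : EuclideanSpace ℝ (Fin n) → EuclideanSpace ℝ (Fin n) → ℝ := fun z y =>
    φ (opSymbol B z (diracOp L u y))
  have cg0 : Continuous fun y => G (y - p) y := by
    have : Continuous fun y => opSymbol B (y - p) := by fun_prop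
    exact φ.continuous.comp (this.clm_apply cD)
  have cg1 : Continuous fun y => G e y := φ.continuous.comp ((opSymbol B e).continuous.comp cD)
  have sg0 : HasCompactSupport fun y => G (y - p) y :=
    sD.mono fun z hz hz' => hz (by simp [G, hz'])
  have sg1 : HasCompactSupport fun y => G e y :=
    sD.mono fun z hz hz' => hz (by simp [G, hz'])
  have zD : ∀ y, ‖y - p‖ < R / 2 → diracOp L u y = 0 := fun y hy => huD y (mem_ball_iff_norm.2 hy)
  have z0 : ∀ y, ‖y - p‖ < R / 2 → G (y - p) y = 0 := fun y hy => by simp [G, zD y hy]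
  have z1 : ∀ y, ‖y - p‖ < R / 2 → G e y = 0 := fun y hy => by simp [G, zD y hy]
  obtain ⟨a, ha⟩ : ∃ a : ℝ, a = -(n : ℝ) / 2 := ⟨_, rfl⟩
  have ha0 : a ≤ 0 := by
    have : (0 : ℝ) ≤ n := n.cast_nonneg
    rw [ha]; linarith
  have hR2 : 0 < R / 2 := half_pos hR
  let b : ℂ → EuclideanSpace ℝ (Fin n) → ℂ := fun ζ y =>
    (‖y - p‖ ^ 2 : ℝ) - 2 * ζ * (inner ℝ (y - p) e : ℝ) + ζ ^ 2 * (‖e‖ ^ 2 : ℝ)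
  -- The two integrals come from the linear splitting `B(y - p - t e) = B(y - p) - t B(e)`.
  let f : ℂ → ℂ := fun ζ =>
    (∫ y, b ζ y ^ (a : ℂ) * (G (y - p) y : ℂ)) - ζ * ∫ y, b ζ y ^ (a : ℂ) * (G e y : ℂ)
  have hf : DifferentiableOn ℂ f (Metric.ball 0 2) :=
    (differentiableOn_integral_cpow hR2 (by linarith) a ha0 cg0 sg0 z0).sub
      (differentiableOn_id.mul
        (differentiableOn_integral_cpow hR2 (by linarith) a ha0 cg1 sg1 z1))
  have hft : ∀ t : ℝ, |t| < 2 → f t = -((cauchyMass n * φ (u (p + t • e)) : ℝ) : ℂ) := by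
    intro t ht
    -- `‖t e‖ ≤ R/8`, and `R/4 + R/8 < R/2`: the cut-off function is still annihilated near each
    -- point of the segment.
    have hnear : ∀ y, ‖y - (p + t • e)‖ < R / 4 → ‖y - p‖ < R / 2 := by
      intro y hy
      have h1 : ‖y - p‖ ≤ ‖y - (p + t • e)‖ + ‖t • e‖ := by
        refine (norm_add_le _ _).trans' (le_of_eq ?_)
        congr 1; abel
      have h2 : ‖t • e‖ ≤ 2 * (R / 16) := by
        rw [norm_smul, Real.norm_eq_abs]
        exact mul_le_mul ht.le hx.le (norm_nonneg _) (by norm_num)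
      linarith
    have hR4 : 0 < R / 4 := by positivity
    have hb : ∀ y, b t y = ((‖y - (p + t • e)‖ ^ 2 : ℝ) : ℂ) := by
      intro y
      rw [show y - (p + t • e) = (y - p) - t • e by abel, norm_sub_sq_real, norm_smul,
        inner_smul_right, mul_pow, Real.norm_eq_abs, sq_abs]
      simp only [b]
      push_cast
      ring
    have hI : ∀ g : EuclideanSpace ℝ (Fin n) → ℝ, ∫ y, b t y ^ (a : ℂ) * (g y : ℂ) =
        ((∫ y, (‖y - (p + t • e)‖ ^ 2) ^ a • g y : ℝ) : ℂ) := by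
      intro g
      rw [← integral_complex_ofReal]
      refine integral_congr_ae (Eventually.of_forall fun y => ?_)
      dsimp only
      rw [hb, ← Complex.ofReal_cpow (sq_nonneg _), smul_eq_mul]
      push_cast
      rfl
    have hrep := cauchy_representation h hu hc hR4 (x := p + t • e) fun y hy => zD y (hnear y hy)
    rw [← ha] at hrep
    have cgt : Continuous fun y => opSymbol B (y - (p + t • e)) (diracOp L u y) := by
      have : Continuous fun y => opSymbol B (y - (p + t • e)) := by fun_prop
      exact this.clm_apply cD
    have hint := integrable_kernel_smul hR4 ha0 (x := p + t • e) cgt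
      (sD.mono fun z hz hz' => hz (by simp [hz'])) fun y hy => by simp [zD y (hnear y hy)]
    have hφ := congrArg φ hrep
    rw [map_smul, map_neg, ← φ.integral_comp_comm hint, smul_eq_mul] at hφ
    rw [hφ]
    simp only [f, hI]
    rw [← Complex.ofReal_mul, ← Complex.ofReal_sub, ← Complex.ofReal_neg, neg_neg,
      ← integral_const_mul, ← integral_sub
        (integrable_kernel_smul hR4 ha0 cg0 sg0 fun y hy => z0 y (hnear y hy))
        ((integrable_kernel_smul hR4 ha0 cg1 sg1 fun y hy => z1 y (hnear y hy)).const_mul _)]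
    congr 1
    refine integral_congr_ae (Eventually.of_forall fun y => ?_)
    dsimp only
    rw [show y - (p + t • e) = (y - p) - t • e by abel]
    simp only [G, map_sub, map_smul, sub_apply, smul_apply, smul_eq_mul]
    ring
  have hu0 : ∀ᶠ t : ℝ in 𝓝 0, f t = 0 := by
    have hlim : Tendsto (fun t : ℝ => p + t • e) (𝓝 0) (𝓝 p) := by
      have : Continuous fun t : ℝ => p + t • e := by fun_prop
      simpa using this.tendsto 0
    filter_upwards [hlim.eventually h0, hlim.eventually (Metric.ball_mem_nhds p hR2),
      Metric.ball_mem_nhds (0 : ℝ) two_pos] with t h1 h2 h3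
    rw [hft t (by simpa using h3), huF _ h2, h1]
    simp
  have hfreq : ∃ᶠ ζ in 𝓝[≠] (0 : ℂ), f ζ = 0 := by
    have hmap : Tendsto (fun t : ℝ => (t : ℂ)) (𝓝[≠] 0) (𝓝[≠] 0) := by
      refine tendsto_nhdsWithin_of_tendsto_nhds_of_eventually_within _ ?_ ?_
      · have := Complex.continuous_ofReal.tendsto 0
        rw [Complex.ofReal_zero] at this
        exact this.mono_left nhdsWithin_le_nhds
      · exact eventually_nhdsWithin_of_forall fun t ht => by simpa using ht
    exact hmap.frequently (hu0.filter_mono nhdsWithin_le_nhds).frequently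
  have hz := (hf.analyticOnNhd Metric.isOpen_ball).eqOn_zero_of_preconnected_of_frequently_eq_zero
    (convex_ball (0 : ℂ) 2).isPreconnected (Metric.mem_ball_self two_pos) hfreq
  have h1 := hz (show ((1 : ℝ) : ℂ) ∈ Metric.ball (0 : ℂ) 2 by simp)
  rw [hft 1 (by norm_num), one_smul, he, add_sub_cancel,
    huF x (mem_ball_iff_norm.2 (by linarith))] at h1
  have h2 : cauchyMass n * φ (F x) = 0 := by
    simpa only [Pi.zero_apply, neg_eq_zero, Complex.ofReal_eq_zero] using h1
  exact (mul_eq_zero.1 h2).resolve_left (cauchyMass_pos hn).ne'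

/-! ### The maximum principle, locally and globally -/

theorem eventually_eq_of_isLocalMax {W : Type*} [NormedAddCommGroup W] [InnerProductSpace ℝ W]
    [CompleteSpace W] (hn : 0 < n)
    {B L : Fin n → W →L[ℝ] W} (h : CliffordPair B L) {Ω : Set (EuclideanSpace ℝ (Fin n))}
    (hΩ : IsOpen Ω) {F : EuclideanSpace ℝ (Fin n) → W} (hF : ContDiffOn ℝ 1 F Ω)
    (hD : ∀ x ∈ Ω, diracOp L F x = 0) {p : EuclideanSpace ℝ (Fin n)} (hp : p ∈ Ω)
    (hmax : IsLocalMax (fun x => ‖F x‖) p) : F =ᶠ[𝓝 p] fun _ => F p := by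
  obtain ⟨r, hr, hball⟩ := Metric.mem_nhds_iff.1 (inter_mem (hΩ.mem_nhds hp) hmax)
  have hsub : Metric.closedBall p (r / 2) ⊆ Ω :=
    (Metric.closedBall_subset_ball (half_lt_self hr)).trans (hball.trans Set.inter_subset_left)
  obtain ⟨u, hu, hc, huF, huD⟩ := exists_cutoff (r := r / 4) hΩ (hF.sub contDiffOn_const)
    (fun x hx => (diracOp_sub_const F (F p) x).trans (hD x hx)) (by positivity) (by linarith) hsub
  have hR : 0 < (r / 4) ^ 2 := by positivity
  obtain ⟨q, hqc, hqpos, hq0, hq⟩ := exists_mean_value_weight hn h hR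
  have hiff : ∀ y, ‖y - p‖ ^ 2 < (r / 4) ^ 2 → y ∈ Metric.ball p (r / 4) := by
    intro y hy
    rw [mem_ball_iff_norm]
    exact lt_of_pow_lt_pow_left₀ 2 (by positivity) hy
  have hmv := hq u p hu hc fun y hy => huD y (hiff y hy)
  rw [huF p (Metric.mem_ball_self (by positivity)), sub_self, smul_zero] at hmv
  have cq : Continuous fun y => q (‖y - p‖ ^ 2) :=
    hqc.comp_continuous (by fun_prop) fun y => Set.mem_Ici.2 (sq_nonneg _)
  have cu := hu.continuous
  have hint : Integrable fun y => q (‖y - p‖ ^ 2) • u y :=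
    integrable_of_hasCompactSupport_smul cq cu hc
  have hinner : ∫ y, inner ℝ (F p) (q (‖y - p‖ ^ 2) • u y) = 0 := by
    rw [integral_inner hint, ← hmv, inner_zero_right]
  have hqnn : ∀ y, 0 ≤ q (‖y - p‖ ^ 2) := by
    intro y
    rcases lt_or_ge (‖y - p‖ ^ 2) ((r / 4) ^ 2) with hy | hy
    · exact (hqpos _ (sq_nonneg _) hy).le
    · exact (hq0 _ hy).ge
  -- Expanding `‖F p + u y‖² ≤ ‖F p‖²` on the ball; outside it the weight is zero.
  have hle : ∀ y, q (‖y - p‖ ^ 2) * ‖u y‖ ^ 2 ≤ -2 * inner ℝ (F p) (q (‖y - p‖ ^ 2) • u y) := by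
    intro y
    rcases lt_or_ge (‖y - p‖ ^ 2) ((r / 4) ^ 2) with hy | hy
    · have hmem := hiff y hy
      have h1 : ‖F y‖ ≤ ‖F p‖ :=
        (hball (Metric.ball_subset_ball (by linarith) hmem)).2
      have h2 : F y = F p + u y := by rw [huF y hmem]; abel
      have h3 := norm_add_sq_real (F p) (u y)
      rw [← h2] at h3
      have h4 : ‖F y‖ ^ 2 ≤ ‖F p‖ ^ 2 := pow_le_pow_left₀ (norm_nonneg _) h1 2
      rw [inner_smul_right]
      nlinarith [hqnn y]
    · simp [hq0 _ hy]
  have cw : Continuous fun y => q (‖y - p‖ ^ 2) * ‖u y‖ ^ 2 := cq.mul (cu.norm.pow 2)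
  have sw : HasCompactSupport fun y => q (‖y - p‖ ^ 2) * ‖u y‖ ^ 2 := by
    refine hc.mono fun z hz hz' => hz ?_
    simp [hz']
  have hzero : ∀ y, q (‖y - p‖ ^ 2) * ‖u y‖ ^ 2 = 0 := by
    by_contra! hne
    obtain ⟨y, hy⟩ := hne
    have hpos := cw.integral_pos_of_hasCompactSupport_nonneg_nonzero (μ := volume) sw
      (fun y => mul_nonneg (hqnn y) (sq_nonneg _)) hy
    have := integral_mono (cw.integrable_of_hasCompactSupport sw)
      ((hint.const_inner (F p)).const_mul (-2)) hle
    rw [integral_const_mul, hinner] at this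
    linarith
  filter_upwards [Metric.ball_mem_nhds p (show 0 < r / 4 by positivity)] with y hy
  have hy2 : ‖y - p‖ ^ 2 < (r / 4) ^ 2 :=
    pow_lt_pow_left₀ (mem_ball_iff_norm.1 hy) (norm_nonneg _) two_ne_zero
  have h1 := (mul_eq_zero.1 (hzero y)).resolve_left (hqpos _ (sq_nonneg _) hy2).ne'
  have h2 : u y = 0 := by simpa using h1
  rw [huF y hy] at h2
  exact sub_eq_zero.1 h2

end

/-- The maximum modulus principle for a Dirac operator with constant coefficients. -/
theorem eq_const_of_isLocalMax_norm {n : ℕ} {W : Type*} [NormedAddCommGroup W]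
    [InnerProductSpace ℝ W] [CompleteSpace W] (hn : 0 < n)
    {B L : Fin n → W →L[ℝ] W} (h : CliffordPair B L) {Ω : Set (EuclideanSpace ℝ (Fin n))}
    (hΩ : IsOpen Ω) (hconn : IsPreconnected Ω) {F : EuclideanSpace ℝ (Fin n) → W}
    (hF : ContDiffOn ℝ 1 F Ω) (hD : ∀ x ∈ Ω, diracOp L F x = 0) {p : EuclideanSpace ℝ (Fin n)}
    (hp : p ∈ Ω) (hmax : IsLocalMax (fun x => ‖F x‖) p) : ∀ x ∈ Ω, F x = F p := by
  set U : Set (EuclideanSpace ℝ (Fin n)) := {x | F =ᶠ[𝓝 x] fun _ => F p} with hU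
  have hUo : IsOpen U := isOpen_iff_mem_nhds.2 fun x hx => hx.eventually_nhds
  have hsub : Ω ⊆ U := by
    -- `U` is open and nonempty in `Ω`, so it remains to see that it is relatively closed.
    refine hconn.subset_of_closure_inter_subset hUo
      ⟨p, hp, eventually_eq_of_isLocalMax hn h hΩ hF hD hp hmax⟩ ?_
    rintro x ⟨hx, hxΩ⟩
    obtain ⟨r, hr, hball⟩ := Metric.isOpen_iff.1 hΩ x hxΩ
    -- Unique continuation from `y` with `R = r/2` reaches radius `r/32`, which covers the ball of
    -- radius `r/64` about `x`.
    obtain ⟨y, hy, hxy⟩ := Metric.mem_closure_iff.1 hx (r / 64) (by positivity)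
    have hsub : Metric.closedBall y (r / 2) ⊆ Ω := by
      refine (Metric.closedBall_subset_ball' ?_).trans hball
      rw [dist_comm]; linarith
    have hy0 : (fun z => F z - F p) =ᶠ[𝓝 y] 0 := by
      filter_upwards [show F =ᶠ[𝓝 y] fun _ => F p from hy] with z hz
      simp [hz]
    filter_upwards [Metric.ball_mem_nhds x (show 0 < r / 64 by positivity)] with z hz
    refine sub_eq_zero.1 (eq_zero_on_ball_of_eventually_eq_zero hn h hΩ (hF.sub contDiffOn_const)
      (fun x hx => (diracOp_sub_const F (F p) x).trans (hD x hx)) (half_pos hr) hsub hy0 ?_)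
    rw [← dist_eq_norm]
    have := dist_triangle z x y
    have := Metric.mem_ball.1 hz
    linarith
  exact fun x hx => (hsub hx).self_of_nhds

/-! ### From the alternative algebra to Clifford operators -/

/-- Polarization of `a (a c) = (a a) c`; it replaces associativity in the Clifford relations. -/
theorem IsAlternative.mul_mul_add_mul_mul {A : Type*} [NonAssocRing A] (hA : IsAlternative A)
    (a b c : A) : a * (b * c) + b * (a * c) = (a * b + b * a) * c := by
  have h1 := (hA (a + b) c).1
  have h2 := (hA a c).1
  have h3 := (hA b c).1
  simp only [associator_apply, add_mul, mul_add] at h1 h2 h3 ⊢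
  have h4 : a * a * c = a * (a * c) := sub_eq_zero.1 h2
  have h5 : b * b * c = b * (b * c) := sub_eq_zero.1 h3
  rw [h4, h5] at h1
  rw [eq_comm, ← sub_eq_zero, ← h1]
  abel

theorem mul_self_of_mem_imaginaryUnits {A : Type*} [NonAssocRing A] [StarRing A] {a : A}
    (ha : a ∈ imaginaryUnits A) :
    a * a = -1 := by
  have h : star a = -a := eq_neg_of_add_eq_zero_right ha.1
  have := ha.2
  rw [h, mul_neg] at this
  rw [← this, neg_neg]

section
variable {A : Type*} [NonAssocRing A] [Module ℝ A] {m d : ℕ}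

/-- The coordinates of an element with respect to a basis, as a vector of a Euclidean space. -/
noncomputable def euclideanCoord (w : Module.Basis (Fin (d + 1)) ℝ A) :
    A ≃ₗ[ℝ] EuclideanSpace ℝ (Fin (d + 1)) :=
  w.equivFun.trans (WithLp.linearEquiv 2 ℝ (Fin (d + 1) → ℝ)).symm

theorem euclideanCoord_apply (w : Module.Basis (Fin (d + 1)) ℝ A) (a : A) (t : Fin (d + 1)) :
    euclideanCoord w a t = w.repr a t := rfl

theorem norm_euclideanCoord (w : Module.Basis (Fin (d + 1)) ℝ A) (a : A) :
    ‖euclideanCoord w a‖ = basisNorm w a := by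
  simp [EuclideanSpace.norm_eq, basisNorm, euclideanCoord_apply]

/-- Left multiplication in coordinates. -/
noncomputable def coordMulLeft [SMulCommClass ℝ A A] (w : Module.Basis (Fin (d + 1)) ℝ A) (a : A) :
    EuclideanSpace ℝ (Fin (d + 1)) →L[ℝ] EuclideanSpace ℝ (Fin (d + 1)) :=
  LinearMap.toContinuousLinearMap
    ((euclideanCoord w).toLinearMap ∘ₗ LinearMap.mulLeft ℝ a ∘ₗ (euclideanCoord w).symm.toLinearMap)

theorem coordMulLeft_coord [SMulCommClass ℝ A A] (w : Module.Basis (Fin (d + 1)) ℝ A) (a b : A) :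
    coordMulLeft w a (euclideanCoord w b) = euclideanCoord w (a * b) := by
  simp [coordMulLeft]

theorem contDiffOn_coord {w : Module.Basis (Fin (d + 1)) ℝ A}
    {f : EuclideanSpace ℝ (Fin (m + 1)) → A} {Ω : Set (EuclideanSpace ℝ (Fin (m + 1)))}
    (hf : ∀ t, ContDiffOn ℝ 1 (component w f t) Ω) :
    ContDiffOn ℝ 1 (fun x => euclideanCoord w (f x)) Ω :=
  contDiffOn_euclidean.2 hf

theorem fderiv_coord_apply {w : Module.Basis (Fin (d + 1)) ℝ A}
    {f : EuclideanSpace ℝ (Fin (m + 1)) → A} {x : EuclideanSpace ℝ (Fin (m + 1))}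
    (hf : DifferentiableAt ℝ (fun x => euclideanCoord w (f x)) x) (s : Fin (m + 1)) :
    fderiv ℝ (fun x => euclideanCoord w (f x)) x (EuclideanSpace.single s 1) =
      euclideanCoord w (partialDeriv w f s x) := by
  ext t
  have h1 : HasFDerivAt (component w f t) ((EuclideanSpace.proj t).comp
      (fderiv ℝ (fun x => euclideanCoord w (f x)) x)) x :=
    (EuclideanSpace.proj t : EuclideanSpace ℝ (Fin (d + 1)) →L[ℝ] ℝ).hasFDerivAt.comp x
      hf.hasFDerivAt
  rw [euclideanCoord_apply, partialDeriv, Module.Basis.repr_sum_self, h1.fderiv]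
  rfl

theorem diracOp_coord [SMulCommClass ℝ A A] {w : Module.Basis (Fin (d + 1)) ℝ A}
    (v : Fin (m + 1) → A)
    {f : EuclideanSpace ℝ (Fin (m + 1)) → A} {x : EuclideanSpace ℝ (Fin (m + 1))}
    (hf : DifferentiableAt ℝ (fun x => euclideanCoord w (f x)) x) :
    diracOp (fun s => coordMulLeft w (v s)) (fun x => euclideanCoord w (f x)) x =
      euclideanCoord w (∑ s, v s * partialDeriv w f s x) := by
  simp only [diracOp, fderiv_coord_apply hf, coordMulLeft_coord, map_sum]

/-- The sign flip for `s ≠ 0` is conjugation. It cancels the mixed terms with `v 0 = 1` and turns `v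
s * v s = -1` into `+1`. -/
theorem cliffordPair_coordMulLeft [IsScalarTower ℝ A A] [SMulCommClass ℝ A A] [StarRing A]
    (hA : IsAlternative A) {M : Submodule ℝ A} {v : Module.Basis (Fin (m + 1)) ℝ M}
    (hv : IsHypercomplexBasis v) (w : Module.Basis (Fin (d + 1)) ℝ A) :
    CliffordPair (fun s => if s = 0 then coordMulLeft w (v s : A) else -coordMulLeft w (v s : A))
      (fun s => coordMulLeft w (v s : A)) := by
  obtain ⟨-, h0, hunit, hanti⟩ := hv
  intro r s a
  obtain ⟨c, rfl⟩ := (euclideanCoord w).surjective a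
  have hkey := hA.mul_mul_add_mul_mul (v r : A) (v s : A) c
  by_cases hr : r = 0
  · subst hr
    by_cases hs : s = 0
    · subst hs
      simp [coordMulLeft_coord, h0, two_smul]
    · simp [coordMulLeft_coord, h0, hs, Ne.symm hs]
  · by_cases hs : s = 0
    · subst hs
      simp [coordMulLeft_coord, h0, hr]
    · have e : ((v r : A) * (v s : A) + (v s : A) * (v r : A)) * c =
          -((if r = s then (2 : ℝ) else 0) • c) := by
        split_ifs with hrs
        · subst hrs
          rw [mul_self_of_mem_imaginaryUnits (hunit r hr), two_smul, add_mul, neg_one_mul, neg_add]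
        · rw [hanti r s hr hs hrs]
          simp
      simp only [if_neg hr, if_neg hs, neg_apply, coordMulLeft_coord]
      rw [← neg_add, ← map_add, hkey, e, map_neg, neg_neg, map_smul]

end

end

theorem mainTheorem8 {A : Type*} [NonAssocRing A] [Module ℝ A] [IsScalarTower ℝ A A]
    [SMulCommClass ℝ A A] [StarRing A] [StarModule ℝ A] (hA : IsAlternative A)
    {m d : ℕ} (hmd : m + 1 ≤ d + 1)
    (M : Submodule ℝ A) (hM : IsHypercomplexSubspace M)
    (v : Module.Basis (Fin (m + 1)) ℝ M) (hv : IsHypercomplexBasis v)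
    (w : Module.Basis (Fin (d + 1)) ℝ A) (hw : ∀ s, w (Fin.castLE hmd s) = (v s : A))
    (Ω : Set (EuclideanSpace ℝ (Fin (m + 1)))) (hΩ_open : IsOpen Ω) (hΩ_conn : IsConnected Ω)
    (hΩ_bdd : Bornology.IsBounded Ω) (hΩ_smooth : HasSmoothBoundary Ω)
    (f : EuclideanSpace ℝ (Fin (m + 1)) → A) (hf : IsLeftMonogenicOn v w f Ω)
    (x₀ : EuclideanSpace ℝ (Fin (m + 1))) (hx₀ : x₀ ∈ Ω)
    (hmax : IsLocalMaxOn (fun x => basisNorm w (f x)) Ω x₀) :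
    ∃ c : A, ∀ x ∈ Ω, f x = c := by
  have hF := contDiffOn_coord hf.1
  have hD : ∀ x ∈ Ω, diracOp (fun s => coordMulLeft w (v s : A))
      (fun x => euclideanCoord w (f x)) x = 0 := by
    intro x hx
    rw [diracOp_coord (fun s => (v s : A))
      ((hF.contDiffAt (hΩ_open.mem_nhds hx)).differentiableAt one_ne_zero), hf.2 x hx, map_zero]
  have hmax' : IsLocalMax (fun x => ‖euclideanCoord w (f x)‖) x₀ := by
    simp only [norm_euclideanCoord]
    exact hmax.isLocalMax (hΩ_open.mem_nhds hx₀)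
  exact ⟨f x₀, fun x hx => (euclideanCoord w).injective
    (eq_const_of_isLocalMax_norm m.succ_pos (cliffordPair_coordMulLeft hA hv w) hΩ_open
      hΩ_conn.isPreconnected hF hD hx₀ hmax' x hx)⟩
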